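/- **Setting.** Fix lanes $1,\dots,N$ and a set of vehicles. A traffic snapshot gives each vehicle $c$ a position $\mathrm{pos}(c)\in\mathbb R$, a physical size $\mathrm{ps}(c)>0$, a braking distance $\mathrm{sd}(c)\ge 0$, a set $\mathrm{res}(c)$ of reserved lanes and a set $\mathrm{clm}(c)$ of claimed lanes. These sets are disjoint, all lanes in $\mathrm{res}(c)\cup\mathrm{clm}(c)$ are equal or adjacent, and $1\le|\mathrm{res}(c)|$, $|\mathrm{clm}(c)|\le 1$, $|\mathrm{res}(c)|+|\mathrm{clm}(c)|\le 2$. A vehicle occupies the interval $[\mathrm{pos}(c),\mathrm{pos}(c)+\mathrm{ps}(c)+\mathrm{sd}(c)]$ on each of its reserved (claimed) lanes. A snapshot changes by the instantaneous actions $\mathsf c(c,n)$ (claim lane $n$, adjacent to the single reserved lane), $\mathsf r(c)$ (turn the claim into a reservation), $\mathsf{wd\,c}(c)$ (withdraw the claim), $\mathsf{wd\,r}(c,n)$ (shrink a two-lane reservation to its lane $n$), and by the passing of time, during which positions and braking distances vary continuously and everything else is fixed. In the road model $R$ a positive amount of time must pass after each action before the next one; the general spatial model has no such restriction. Spatial formulas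 are evaluated on a snapshot and a view (a set of lanes and a bounded interval). $\mathrm{re}(c)$ (resp. $\mathrm{cl}(c)$) says that the view is a single lane with an interval of positive length, fully occupied by the reservation (resp. claim) of $c$; $\langle\varphi\rangle$ says that $\varphi$ holds on some part of the view. Put $$\mathrm{pcc}(c,d)\equiv c\ne d\wedge\langle \mathrm{cl}(d)\wedge(\mathrm{re}(c)\vee \mathrm{cl}(c))\rangle .$$ The spatial controller $S$ of a vehicle $\mathit{ego}$, with constants $t_{dl}<t_{lc}$, is the following timed automaton with a clock $x$, a current lane $n$ and a target lane $l$, initially in location *idle* with $x=0$. From *idle*, on $\mathsf{change\_lane\_join}$ or $\mathsf{change\_lane\_leave}$, it claims a lane adjacent to $n$, stores it in $l$, resets $x$ and moves to *wait* (invariant $x\le t_{dl}$). From *wait* it either withdraws the claim and returns to *idle* ($\mathsf{abort}$, guard $x>0$), or performs $\mathsf r(\mathit{ego})$ and moves to *change* ($\mathsf{phys\_changing\_lane}$, guard $0<x<t_{dl}$ and $\neg\exists c\colon\mathrm{pcc}(c,\mathit{ego})$ in the view of $\mathit{ego}$). From *change* (invariant $x\le t_{lc}$) it moves to a committed location ($\mathsf{phys\_changed\_lane}$,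 guard $x>0$), and from there back to *idle*, shrinking its reservation to $l$ and setting $n:=l$ ($\mathsf{changed\_lane}$). The spatial actions of $\mathit{ego}$ are performed only by this controller, and the view of $\mathit{ego}$ always contains the space claimed by $\mathit{ego}$. Let $1\neq2$ be two vehicles, the platoon, and let $$P=A_1\|V_1\|S_1\|\mathit{Comms}12\|A_2\|V_2\|S_2\|R ,$$ where $S_i$ is the spatial controller of vehicle $i$, the agents $A_i$, the continuous controllers $V_i$ and the communication component $\mathit{Comms}12$ are arbitrary automata, and $\|$ is parallel composition synchronising on common labels. $[\![X]\!]$ denotes the set of (finite) traces of $X$. For a set $W$ of vehicles, a vehicle $d$ *follows the protocol with respect to $W$* on a trace if no step $\mathsf r(d)$ occurs in a snapshot in which, in some view, $\mathrm{pcc}(c,d)$ holds for some $c\in W$. The trace satisfies the lane-change protocol $\mathsf{LC}_W$, i.e. always $\forall d\colon(\exists c\in W\colon\mathrm{pcc}(c,d))\Rightarrow\Box_{\mathsf r(d)}\bot$, if every vehicle $d$ follows the protocol with respect to $W$. It satisfies $\mathsf{DC}_W$ (distance keeping) if, whenever the reservations of a vehicle $e\in W$ and a vehicle $c\neq e$ do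 not overlap at the beginning of a time delay, they do not overlap during this delay. The *general controller specification* (with respect to $W$) is the set of traces of the general spatial model that satisfy $\mathsf{DC}_W$ and $\mathsf{LC}_W$. Finally, $\mathsf{safe}(e)$ says that at all times and in every view $\neg\exists c\colon c\neq e\wedge\langle\mathrm{re}(e)\wedge\mathrm{re}(c)\rangle$. **Theorem.** 1. For $i\in\{1,2\}$, neither $[\![S_i]\!]$ nor $[\![P]\!]$ contains a trace in which vehicle $i$ performs $\mathsf r(i)$ in a snapshot where, in some view, $\exists c\colon\mathrm{pcc}(c,i)$ holds ($c$ ranging over all vehicles). 2. Let $W$ be either the platoon $\{1,2\}$ or the set of all vehicles, and let $tr\in[\![P]\!]$ be a trace on which all vehicles outside the platoon follow the protocol with respect to $W$. Then $tr$ satisfies $\mathsf{LC}_W$. If moreover $tr$ satisfies $\mathsf{DC}_W$, then $tr$ belongs to the general controller specification (so, under these assumptions, $P$ refines it); and if, in addition, the initial snapshot is free of collisions with vehicles in $W$ (no reservation overlaps that of any $e\in W$), then $tr$ satisfies $\mathsf{safe}(e)$ for all $e\in W$. -/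

import Mathlib

/-! ## The spatial model: lanes, vehicles, traffic snapshots -/

/-- Two neighbouring lanes of a motorway with lanes indexed by `Fin N`. -/
def AdjacentLanes {N : ℕ} (l m : Fin N) : Prop :=
  l.val + 1 = m.val ∨ m.val + 1 = l.val

/-- A traffic snapshot: for each vehicle its position, physical size, braking distance, the lanes
it reserves and the lanes it claims, with the usual sanity conditions. -/
structure Snapshot (V : Type*) (N : ℕ) where
  /-- position (rear end) on the infinitely long motorway -/
  pos : V → ℝ
  /-- physical size -/
  ps : V → ℝ
  /-- braking distance -/
  sd : V → ℝ
  /-- reserved lanes -/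
  res : V → Finset (Fin N)
  /-- claimed lanes -/
  clm : V → Finset (Fin N)
  ps_pos : ∀ c, 0 < ps c
  sd_nonneg : ∀ c, 0 ≤ sd c
  res_disjoint_clm : ∀ c, Disjoint (res c) (clm c)
  one_le_res : ∀ c, 1 ≤ (res c).card
  clm_le_one : ∀ c, (clm c).card ≤ 1
  res_add_clm_le_two : ∀ c, (res c).card + (clm c).card ≤ 2
  neighbours : ∀ c, ∀ l ∈ res c ∪ clm c, ∀ m ∈ res c ∪ clm c, l = m ∨ AdjacentLanes l m

/-- The stretch of road needed by a vehicle: its physical extent and its braking distance. -/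
def Snapshot.envelope {V : Type*} {N : ℕ} (ts : Snapshot V N) (c : V) : Set ℝ :=
  Set.Icc (ts.pos c) (ts.pos c + ts.ps c + ts.sd c)

/-- The instantaneous spatial actions of the vehicles. -/
inductive SpatialAction (V : Type*) (N : ℕ) where
  /-- create a claim of vehicle `c` on lane `n` -/
  | claim (c : V) (n : Fin N)
  /-- change the claim of `c` into a reservation -/
  | reserve (c : V)
  /-- withdraw the claim of `c` -/
  | withdrawClaim (c : V)
  /-- shrink the reservation of `c` to lane `n` -/
  | withdrawReservation (c : V) (n : Fin N)

/-- The vehicle that performs a spatial action. -/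
def SpatialAction.actor {V : Type*} {N : ℕ} : SpatialAction V N → V
  | .claim c _ => c
  | .reserve c => c
  | .withdrawClaim c => c
  | .withdrawReservation c _ => c

/-- The effect of a spatial action on the reservation and the claim of the acting vehicle. -/
def SpatialAction.LocalEffect {V : Type*} {N : ℕ} (ts ts' : Snapshot V N) :
    SpatialAction V N → Prop
  | .claim c n => ts.clm c = ∅ ∧ (ts.res c).card = 1 ∧ (∃ m ∈ ts.res c, AdjacentLanes m n) ∧
      ts'.res c = ts.res c ∧ ts'.clm c = {n}
  | .reserve c => ts'.res c = ts.res c ∪ ts.clm c ∧ ts'.clm c = ∅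
  | .withdrawClaim c => ts'.res c = ts.res c ∧ ts'.clm c = ∅
  | .withdrawReservation c n => n ∈ ts.res c ∧ (ts.res c).card = 2 ∧
      ts'.res c = {n} ∧ ts'.clm c = ts.clm c

/-- `ts` becomes `ts'` by the instantaneous spatial action `a`; everything that does not concern
the reservation and claim of the acting vehicle is unchanged. -/
def SpatialStep {V : Type*} {N : ℕ} (ts : Snapshot V N) (a : SpatialAction V N)
    (ts' : Snapshot V N) : Prop :=
  ts'.pos = ts.pos ∧ ts'.ps = ts.ps ∧ ts'.sd = ts.sd ∧
  (∀ c, c ≠ a.actor → ts'.res c = ts.res c ∧ ts'.clm c = ts.clm c) ∧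
  a.LocalEffect ts ts'

/-- The passing of `d` time units along the trajectory `σ`: reservations, claims and physical sizes
stay fixed, positions and braking distances vary continuously, with no further restriction on the
dynamics of the vehicles. -/
def Evolution {V : Type*} {N : ℕ} (d : ℝ) (σ : ℝ → Snapshot V N) : Prop :=
  0 < d ∧
  (∀ t ∈ Set.Icc 0 d, (σ t).res = (σ 0).res ∧ (σ t).clm = (σ 0).clm ∧ (σ t).ps = (σ 0).ps) ∧
  (∀ c, ContinuousOn (fun t => (σ t).pos c) (Set.Icc 0 d)) ∧
  (∀ c, ContinuousOn (fun t => (σ t).sd c) (Set.Icc 0 d))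

/-! ## Views and spatial formulas -/

/-- A view: a set of lanes together with a finite interval, its extension. -/
structure View (N : ℕ) where
  lanes : Finset (Fin N)
  lo : ℝ
  hi : ℝ
  lo_le_hi : lo ≤ hi

/-- `u.Sub v`: the view `u` is a part of the view `v`. -/
def View.Sub {N : ℕ} (u v : View N) : Prop :=
  u.lanes ⊆ v.lanes ∧ v.lo ≤ u.lo ∧ u.hi ≤ v.hi

/-- Spatial formulas, identified with their truth value on a snapshot and a view. -/
abbrev SpatialFormula (V : Type*) (N : ℕ) := Snapshot V N → View N → Prop

namespace SpatialFormula

variable {V : Type*} {N : ℕ}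

/-- The view is a single lane with an extension of positive length, fully occupied by the
reservation of `c`. -/
def re (c : V) : SpatialFormula V N := fun ts v =>
  v.lo < v.hi ∧ (∃ l ∈ ts.res c, v.lanes = {l}) ∧ Set.Icc v.lo v.hi ⊆ ts.envelope c

/-- The view is a single lane with an extension of positive length, fully occupied by the
claim of `c`. -/
def cl (c : V) : SpatialFormula V N := fun ts v =>
  v.lo < v.hi ∧ (∃ l ∈ ts.clm c, v.lanes = {l}) ∧ Set.Icc v.lo v.hi ⊆ ts.envelope c

/-- The formula holds somewhere on the space under consideration. -/
def somewhere (φ : SpatialFormula V N) : SpatialFormula V N := fun ts v =>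
  ∃ u : View N, u.Sub v ∧ φ ts u

/-- Potential collision: the claim of `d` overlaps the reservation or the claim of `c`. -/
def pcc (c d : V) : SpatialFormula V N := fun ts v =>
  c ≠ d ∧ somewhere (fun ts u => cl d ts u ∧ (re c ts u ∨ cl c ts u)) ts v

/-- The reservations of `e` and `c` overlap somewhere. -/
def overlap (e c : V) : SpatialFormula V N :=
  somewhere (fun ts u => re e ts u ∧ re c ts u)

/-- No vehicle other than `e` has a reservation that overlaps the reservation of `e`. -/
def noCollision (e : V) : SpatialFormula V N := fun ts v =>
  ¬ ∃ c, c ≠ e ∧ overlap e c ts v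

end SpatialFormula

/-! ## Labels, automata, parallel composition -/

/-- The channels over which a spatial controller communicates. -/
inductive ControllerChannel where
  | changeLaneJoin
  | changeLaneLeave
  | abort
  | changedLane
  | physChangingLane
  | physChangedLane

/-- All channels: those of the spatial controller of a vehicle, and channels `K` between the
remaining components. -/
inductive Channel (V K : Type*) where
  | ctrl (c : V) (ch : ControllerChannel)
  | other (k : K)

/-- One step of the system. A discrete step may synchronise over a channel and may perform a spatial
action; it carries the snapshots before and after it, so that components can evaluate spatial
guards. A delay carries its duration and the evolution of the snapshot. -/
inductive Label (V K : Type*) (N : ℕ) where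
  | disc (sync : Option (Channel V K)) (act : Option (SpatialAction V N)) (ts ts' : Snapshot V N)
  | delay (d : ℝ) (σ : ℝ → Snapshot V N)

namespace Label

variable {V K : Type*} {N : ℕ}

/-- The snapshot before the step. -/
def src : Label V K N → Snapshot V N
  | .disc _ _ ts _ => ts
  | .delay _ σ => σ 0

/-- The snapshot after the step. -/
def dst : Label V K N → Snapshot V N
  | .disc _ _ _ ts' => ts'
  | .delay d σ => σ d

/-- All snapshots that occur before, during and after the step. -/
def snapshots : Label V K N → Set (Snapshot V N)
  | .disc _ _ ts ts' => {ts, ts'}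
  | .delay d σ => σ '' Set.Icc 0 d

/-- The step changes the claim of `c` into a reservation. -/
def IsReserve (c : V) : Label V K N → Prop
  | .disc _ act _ _ => act = some (.reserve c)
  | .delay _ _ => False

/-- The step involves the spatial controller of `c`: it uses one of its channels, or it is a spatial
action of `c`. -/
def Concerns (c : V) : Label V K N → Prop
  | .disc sync act _ _ => (∃ ch, sync = some (.ctrl c ch)) ∨ (∃ a, act = some a ∧ a.actor = c)
  | .delay _ _ => False

end Label

/-- An automaton with labels `L` and states `Q`. It takes part in exactly the steps whose label is
in its alphabet. -/
structure Automaton (L Q : Type*) where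
  init : Set Q
  alphabet : Set L
  step : Q → L → Q → Prop

namespace Automaton

variable {L Q Q' : Type*}

/-- Behaviour of an automaton inside a larger system: it performs the labels of its alphabet and
does not move under any other label. -/
def Move (A : Automaton L Q) (q : Q) (l : L) (q' : Q) : Prop :=
  (l ∈ A.alphabet ∧ A.step q l q') ∨ (l ∉ A.alphabet ∧ q' = q)

/-- The label sequence `tr` can be executed from state `q`. -/
def Executes (A : Automaton L Q) : Q → List L → Prop
  | _, [] => True
  | q, l :: tr => ∃ q', A.Move q l q' ∧ A.Executes q' tr

/-- The (finite) traces of the automaton. -/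
def behaviour (A : Automaton L Q) : Set (List L) :=
  {tr | ∃ q ∈ A.init, A.Executes q tr}

/-- Parallel composition, synchronising on common labels. -/
def par (A : Automaton L Q) (B : Automaton L Q') : Automaton L (Q × Q') where
  init := A.init ×ˢ B.init
  alphabet := A.alphabet ∪ B.alphabet
  step q l q' := A.Move q.1 l q'.1 ∧ B.Move q.2 l q'.2

end Automaton

infixl:65 " ⫴ " => Automaton.par

/-! ## The road -/

/-- The general spatial model: arbitrarily many spatial actions may happen at one point in time. -/
def spatialModel (V K : Type*) (N : ℕ) : Automaton (Label V K N) (Snapshot V N) where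
  init := Set.univ
  alphabet := Set.univ
  step q l q' := q = l.src ∧ q' = l.dst ∧
    match l with
    | .disc _ none ts ts' => ts' = ts
    | .disc _ (some a) ts ts' => SpatialStep ts a ts'
    | .delay d σ => Evolution d σ

/-- The model of space `R`: as the general model, but after each spatial action a positive amount of
time has to pass before the next one. The flag records whether a spatial action is possible. -/
def road (V K : Type*) (N : ℕ) : Automaton (Label V K N) (Snapshot V N × Bool) where
  init := {q | q.2 = true}
  alphabet := Set.univ
  step q l q' := q.1 = l.src ∧ q'.1 = l.dst ∧
    match l with
    | .disc _ none ts ts' => ts' = ts ∧ q'.2 = q.2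
    | .disc _ (some a) ts ts' => SpatialStep ts a ts' ∧ q.2 = true ∧ q'.2 = false
    | .delay d σ => Evolution d σ ∧ q'.2 = true

/-! ## The spatial controller -/

/-- Locations of the spatial controller; `committed` is a committed location. -/
inductive Location where
  | idle
  | wait
  | change
  | committed

/-- State of the spatial controller: location, clock `x`, current lane `n`, target lane `l`. -/
structure ControllerState (N : ℕ) where
  loc : Location
  x : ℝ
  n : Fin N
  l : Fin N

/-- Location invariants of the spatial controller. -/
def ControllerState.Inv {N : ℕ} (tdl tlc : ℝ) (q : ControllerState N) : Prop :=
  match q.loc with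
  | .wait => q.x ≤ tdl
  | .change => q.x ≤ tlc
  | _ => True

/-- Discrete edges of the spatial controller of vehicle `ego`, whose spatial guard is evaluated in
the view `view ts` that `ego` has of the current snapshot `ts`. -/
inductive ControllerEdge {V K : Type*} {N : ℕ} (ego : V) (view : Snapshot V N → View N)
    (tdl : ℝ) : ControllerState N → Label V K N → ControllerState N → Prop
  | join (x : ℝ) (n l m : Fin N) (ts ts' : Snapshot V N) (hm : AdjacentLanes n m) :
      ControllerEdge ego view tdl ⟨.idle, x, n, l⟩
        (.disc (some (.ctrl ego .changeLaneJoin)) (some (.claim ego m)) ts ts')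
        ⟨.wait, 0, n, m⟩
  | leave (x : ℝ) (n l m : Fin N) (ts ts' : Snapshot V N) (hm : AdjacentLanes n m) :
      ControllerEdge ego view tdl ⟨.idle, x, n, l⟩
        (.disc (some (.ctrl ego .changeLaneLeave)) (some (.claim ego m)) ts ts')
        ⟨.wait, 0, n, m⟩
  | abort (x : ℝ) (n l : Fin N) (ts ts' : Snapshot V N) (hx : 0 < x) :
      ControllerEdge ego view tdl ⟨.wait, x, n, l⟩
        (.disc (some (.ctrl ego .abort)) (some (.withdrawClaim ego)) ts ts')
        ⟨.idle, x, n, l⟩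
  | reserve (x : ℝ) (n l : Fin N) (ts ts' : Snapshot V N) (hx : 0 < x) (hx' : x < tdl)
      (guard : ¬ ∃ c, SpatialFormula.pcc c ego ts (view ts)) :
      ControllerEdge ego view tdl ⟨.wait, x, n, l⟩
        (.disc (some (.ctrl ego .physChangingLane)) (some (.reserve ego)) ts ts')
        ⟨.change, x, n, l⟩
  | changed (x : ℝ) (n l : Fin N) (ts ts' : Snapshot V N) (hx : 0 < x) :
      ControllerEdge ego view tdl ⟨.change, x, n, l⟩
        (.disc (some (.ctrl ego .physChangedLane)) none ts ts')
        ⟨.committed, x, n, l⟩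
  | finish (x : ℝ) (n l : Fin N) (ts ts' : Snapshot V N) :
      ControllerEdge ego view tdl ⟨.committed, x, n, l⟩
        (.disc (some (.ctrl ego .changedLane)) (some (.withdrawReservation ego l)) ts ts')
        ⟨.idle, x, l, l⟩

/-- The spatial controller of vehicle `ego`, initially on lane `n₀`. A discrete step that concerns
the controller follows an edge; in the committed location neither a delay nor a discrete step of
other components is possible. -/
def spatialController {V : Type*} (K : Type*) {N : ℕ} (ego : V) (view : Snapshot V N → View N)
    (tdl tlc : ℝ) (n₀ : Fin N) : Automaton (Label V K N) (ControllerState N) where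
  init := {⟨.idle, 0, n₀, n₀⟩}
  alphabet := Set.univ
  step q l q' := q'.Inv tdl tlc ∧
    match l with
    | .delay d _ => q.loc ≠ .committed ∧ q' = ⟨q.loc, q.x + d, q.n, q.l⟩
    | .disc sync act ts ts' =>
        ControllerEdge ego view tdl q (.disc sync act ts ts') q' ∨
        (¬ (Label.disc sync act ts ts').Concerns ego ∧ q.loc ≠ .committed ∧ q' = q)

/-- The view of `ego` always reaches far enough to contain its own claim. -/
def CoversClaim {V : Type*} {N : ℕ} (ego : V) (view : Snapshot V N → View N) : Prop :=
  ∀ ts : Snapshot V N, ts.clm ego ⊆ (view ts).lanes ∧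
    ts.envelope ego ⊆ Set.Icc (view ts).lo (view ts).hi

/-! ## Properties of traces -/

section TraceProperties

variable {V K : Type*} {N : ℕ}

/-- `□ᵣ₍d₎ φ`: after the step, if it changes the claim of `d` into a reservation, `φ` holds. -/
def BoxReserve (d : V) (φ : SpatialFormula V N) (l : Label V K N) (v : View N) : Prop :=
  l.IsReserve d → φ l.dst v

/-- The lane-change protocol along a trace for the vehicle `d` with respect to the vehicles in `W`:
always, if `∃ c ∈ W, pcc c d`, then `□ᵣ₍d₎ ⊥`. -/
def FollowsLC (W : Set V) (d : V) (tr : List (Label V K N)) : Prop :=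
  ∀ l ∈ tr, ∀ v : View N, (∃ c ∈ W, SpatialFormula.pcc c d l.src v) →
    BoxReserve d (fun _ _ => False) l v

/-- The lane-change protocol `LC` with respect to the vehicles in `W`. -/
def LC (W : Set V) (tr : List (Label V K N)) : Prop :=
  ∀ d, FollowsLC W d tr

/-- The traces in which at some point there is a potential collision for `d` and `d` nevertheless
changes its claim into a reservation. -/
def ReservesInPotentialCollision (d : V) : Set (List (Label V K N)) :=
  {tr | ∃ l ∈ tr, ∃ v : View N, (∃ c, SpatialFormula.pcc c d l.src v) ∧ l.IsReserve d}

/-- Distance keeping with respect to the vehicles in `W`: if the reservations of a vehicle `e` in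
`W` and another vehicle `c` do not overlap, then they do not overlap while time passes. -/
def DC (W : Set V) (tr : List (Label V K N)) : Prop :=
  ∀ (d : ℝ) (σ : ℝ → Snapshot V N), Label.delay d σ ∈ tr → ∀ e ∈ W, ∀ c, c ≠ e →
    (∀ v, ¬ SpatialFormula.overlap e c (σ 0) v) →
    ∀ t ∈ Set.Icc 0 d, ∀ v, ¬ SpatialFormula.overlap e c (σ t) v

/-- `safe e`: at all times, and in every view, no reservation overlaps that of `e`. -/
def Safe (e : V) (tr : List (Label V K N)) : Prop :=
  ∀ l ∈ tr, ∀ ts ∈ l.snapshots, ∀ v, SpatialFormula.noCollision e ts v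

/-- No reservation overlaps that of `e` in the initial snapshot of the trace. -/
def InitiallySafe (e : V) (tr : List (Label V K N)) : Prop :=
  ∀ l ∈ tr.head?, ∀ v, SpatialFormula.noCollision e l.src v

/-- The general controller specification: the traces of the general spatial model in which distance
is kept and the lane-change protocol is followed, with respect to the vehicles in `W`. -/
def GeneralSpecification (W : Set V) : Set (List (Label V K N)) :=
  {tr | tr ∈ (spatialModel V K N).behaviour ∧ DC W tr ∧ LC W tr}

end TraceProperties

/-! Every trace of a composition is a trace of each component, so `P` inherits whatever its
controllers and the road guarantee. A controller can perform a reservation of its own vehicle only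
along the guarded edge; since the view covers the claim, a guard that holds there excludes potential
collisions in every view (`spatialController_inter_reservesInPotentialCollision`). Hence both
platoon vehicles respect all vehicles, and the assumption on the others completes `LC W`. Dropping
the road's waiting condition gives the general model.

Safety is an induction along the trace. Delays are covered by `DC`. A spatial action creates an
overlap only by turning a claim into a reservation, and that claim was then already in a potential
collision (`SpatialStep.overlap_or_pcc`). If the other vehicle `c` reserves, `LC W` forbids it
because `e ∈ W`. If `e` itself reserves, `c` may lie outside `W`; hence the separate requirement
`FollowsLC Set.univ e`. -/

/-! ## Projections of parallel composition -/

namespace Automaton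

variable {L Q Q' : Type*}

theorem Move.of_par {A : Automaton L Q} {B : Automaton L Q'} {q q' : Q × Q'} {l : L}
    (h : (A ⫴ B).Move q l q') : A.Move q.1 l q'.1 ∧ B.Move q.2 l q'.2 := by
  rcases h with ⟨_, h⟩ | ⟨hl, rfl⟩
  · exact h
  -- A label outside the union of the alphabets lies in neither, so both components stay put.
  · exact ⟨.inr ⟨fun h => hl (.inl h), rfl⟩, .inr ⟨fun h => hl (.inr h), rfl⟩⟩

theorem Executes.of_par {A : Automaton L Q} {B : Automaton L Q'} {tr : List L} {q : Q × Q'}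
    (h : (A ⫴ B).Executes q tr) : A.Executes q.1 tr ∧ B.Executes q.2 tr := by
  induction tr generalizing q with
  | nil => exact ⟨trivial, trivial⟩
  | cons l tr ih =>
    obtain ⟨q', hm, he⟩ := h
    exact ⟨⟨q'.1, hm.of_par.1, (ih he).1⟩, ⟨q'.2, hm.of_par.2, (ih he).2⟩⟩

theorem behaviour_par_subset_left (A : Automaton L Q) (B : Automaton L Q') :
    (A ⫴ B).behaviour ⊆ A.behaviour :=
  fun _ ⟨q, hq, he⟩ => ⟨q.1, hq.1, he.of_par.1⟩

theorem behaviour_par_subset_right (A : Automaton L Q) (B : Automaton L Q') :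
    (A ⫴ B).behaviour ⊆ B.behaviour :=
  fun _ ⟨q, hq, he⟩ => ⟨q.2, hq.2, he.of_par.2⟩

theorem Executes.exists_move {A : Automaton L Q} {tr : List L} {q : Q} (h : A.Executes q tr)
    {l : L} (hl : l ∈ tr) : ∃ q₁ q₂, A.Move q₁ l q₂ := by
  induction tr generalizing q with
  | nil => cases hl
  | cons l' tr ih =>
    obtain ⟨q', hm, he⟩ := h
    rcases List.mem_cons.1 hl with rfl | hl
    · exact ⟨q, q', hm⟩
    · exact ih he hl

end Automaton

section LaneChange

variable {V K : Type*} {N : ℕ}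

/-! ## The road refines the general spatial model -/

theorem spatialModel_step_of_road_step {q q' : Snapshot V N × Bool} {l : Label V K N}
    (h : (road V K N).step q l q') : (spatialModel V K N).step q.1 l q'.1 := by
  obtain ⟨h₁, h₂, h⟩ := h
  refine ⟨h₁, h₂, ?_⟩
  rcases l with ⟨_, _ | _, _, _⟩ | _ <;> exact h.1

theorem road_behaviour_subset : (road V K N).behaviour ⊆ (spatialModel V K N).behaviour := by
  rintro tr ⟨q, -, he⟩
  refine ⟨q.1, trivial, ?_⟩
  induction tr generalizing q with
  | nil => trivial
  | cons l tr ih =>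
    obtain ⟨q', ⟨_, hs⟩ | ⟨hl, _⟩, he⟩ := he
    · exact ⟨q'.1, .inl ⟨trivial, spatialModel_step_of_road_step hs⟩, ih q' he⟩
    -- The road's alphabet is everything, so it can never sit out a step.
    · exact absurd trivial hl

/-! ## The spatial controller never reserves in a potential collision -/

/-- The witnessing part is filled by the claim of `ego`, so it lies in any view containing that
claim, and the original view is irrelevant. -/
theorem pcc_of_coversClaim {ego c : V} {view : Snapshot V N → View N}
    (hview : CoversClaim ego view) {ts : Snapshot V N} {v : View N}
    (h : SpatialFormula.pcc c ego ts v) : SpatialFormula.pcc c ego ts (view ts) := by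
  obtain ⟨hne, u, -, hcl, hor⟩ := h
  refine ⟨hne, u, ⟨?_, ?_⟩, hcl, hor⟩
  · obtain ⟨-, ⟨l, hl, hu⟩, -⟩ := hcl
    rw [hu, Finset.singleton_subset_iff]
    exact (hview ts).1 hl
  · exact (Set.Icc_subset_Icc_iff u.lo_le_hi).1 (hcl.2.2.trans (hview ts).2)

theorem spatialController_inter_reservesInPotentialCollision {ego : V}
    {view : Snapshot V N → View N} (hview : CoversClaim ego view) (tdl tlc : ℝ) (n₀ : Fin N) :
    (spatialController K ego view tdl tlc n₀).behaviour ∩ ReservesInPotentialCollision ego = ∅ := by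
  refine Set.eq_empty_of_forall_notMem ?_
  rintro tr ⟨⟨q, -, he⟩, l, hl, v, ⟨c, hc⟩, hr⟩
  obtain ⟨q₁, q₂, ⟨_, -, hs⟩ | ⟨hl', _⟩⟩ := he.exists_move hl
  · rcases l with ⟨sync, act, ts, ts'⟩ | _
    · obtain rfl : act = some (.reserve ego) := hr
      rcases hs with hs | ⟨hs, -⟩
      · cases hs with
        | reserve _ _ _ _ _ _ _ guard => exact guard ⟨c, pcc_of_coversClaim hview hc⟩
      -- Staying put is reserved for steps that do not concern `ego`, but `ego` is the actor here.
      · exact hs (.inr ⟨_, rfl, rfl⟩)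
    · exact hr
  · exact hl' trivial

theorem followsLC_of_notMem {W : Set V} {d : V} {tr : List (Label V K N)}
    (h : tr ∉ ReservesInPotentialCollision d) : FollowsLC W d tr :=
  fun l hl v ⟨c, _, hc⟩ hr => h ⟨l, hl, v, ⟨c, hc⟩, hr⟩

/-! ## Preservation of safety -/

theorem SpatialStep.envelope_eq {ts ts' : Snapshot V N} {a : SpatialAction V N}
    (h : SpatialStep ts a ts') (c : V) : ts'.envelope c = ts.envelope c := by
  simp only [Snapshot.envelope, h.1, h.2.1, h.2.2.1]

/-- Envelopes do not change, so only lanes matter: reserving adds exactly the claimed lane,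
shrinking keeps a lane already reserved, and the other actions leave reservations alone. -/
theorem SpatialStep.re_or_cl {ts ts' : Snapshot V N} {a : SpatialAction V N}
    (h : SpatialStep ts a ts') {c : V} {u : View N} (hu : SpatialFormula.re c ts' u) :
    SpatialFormula.re c ts u ∨ a = .reserve c ∧ SpatialFormula.cl c ts u := by
  obtain ⟨hlt, ⟨l, hl, hlu⟩, henv⟩ := hu
  rw [h.envelope_eq] at henv
  suffices l ∈ ts.res c ∨ a = .reserve c ∧ l ∈ ts.clm c from
    this.imp (fun hl => ⟨hlt, ⟨l, hl, hlu⟩, henv⟩) fun hl => ⟨hl.1, hlt, ⟨l, hl.2, hlu⟩, henv⟩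
  obtain ⟨-, -, -, hother, hloc⟩ := h
  by_cases hc : c = a.actor
  · subst hc
    cases a with
    | claim d n => exact .inl (hloc.2.2.2.1 ▸ hl)
    | reserve d =>
      exact (Finset.mem_union.1 (hloc.1 ▸ hl)).imp_right fun hl => ⟨rfl, hl⟩
    | withdrawClaim d => exact .inl (hloc.1 ▸ hl)
    | withdrawReservation d n =>
      obtain rfl := Finset.mem_singleton.1 (hloc.2.2.1 ▸ hl)
      exact .inl hloc.1
  · exact .inl ((hother c hc).1 ▸ hl)

/-- An overlap of reservations after a spatial action stems from an overlap before it, or from a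
reservation by one of the two vehicles in a potential collision with the other. -/
theorem SpatialStep.overlap_or_pcc {ts ts' : Snapshot V N} {a : SpatialAction V N}
    (h : SpatialStep ts a ts') {e c : V} (hne : c ≠ e) {v : View N}
    (ho : SpatialFormula.overlap e c ts' v) :
    SpatialFormula.overlap e c ts v ∨
      (a = .reserve e ∧ SpatialFormula.pcc c e ts v) ∨
      (a = .reserve c ∧ SpatialFormula.pcc e c ts v) := by
  obtain ⟨u, hu, he, hc⟩ := ho
  have hc := h.re_or_cl hc
  rcases h.re_or_cl he with he | ⟨ha, he⟩
  · rcases hc with hc | ⟨ha, hc⟩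
    · exact .inl ⟨u, hu, he, hc⟩
    · exact .inr (.inr ⟨ha, hne.symm, u, hu, hc, .inl he⟩)
  · exact .inr (.inl ⟨ha, hne, u, hu, he, hc.imp_right And.right⟩)

/-- During a single step that keeps distance and respects the lane-change protocol, no overlap
with the reservation of `e` arises. -/
theorem noCollision_of_step {q q' : Snapshot V N} {l : Label V K N} {e : V} {W : Set V}
    (he : e ∈ W) (hs : (spatialModel V K N).step q l q') (hDC : DC W [l]) (hLC : LC W [l])
    (hego : FollowsLC Set.univ e [l])
    (h₀ : ∀ v, SpatialFormula.noCollision e l.src v) :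
    ∀ ts ∈ l.snapshots, ∀ v, SpatialFormula.noCollision e ts v := by
  obtain ⟨-, -, hs⟩ := hs
  rcases l with ⟨sync, _ | a, ts, ts'⟩ | ⟨d, σ⟩
  · obtain rfl : ts' = ts := hs
    rintro t (rfl | rfl) <;> exact h₀
  · rintro t (rfl | rfl)
    · exact h₀
    · rintro v ⟨c, hne, ho⟩
      rcases SpatialStep.overlap_or_pcc hs hne ho with ho | ⟨rfl, hp⟩ | ⟨rfl, hp⟩
      · exact h₀ v ⟨c, hne, ho⟩
      -- Nothing puts `c` in `W`, so `LC W` would not suffice here.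
      · exact hego _ (List.mem_singleton_self _) v ⟨c, trivial, hp⟩ rfl
      · exact hLC c _ (List.mem_singleton_self _) v ⟨e, he, hp⟩ rfl
  · rintro _ ⟨t, ht, rfl⟩ v ⟨c, hne, ho⟩
    exact hDC d σ (List.mem_singleton_self _) e he c hne
      (fun v ho => h₀ v ⟨c, hne, ho⟩) t ht v ho

theorem Label.dst_mem_snapshots {q q' : Snapshot V N} {l : Label V K N}
    (hs : (spatialModel V K N).step q l q') : l.dst ∈ l.snapshots := by
  rcases l with _ | ⟨d, σ⟩
  · exact .inr rfl
  -- The end time lies in `[0, d]` because an evolution has positive duration.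
  · exact ⟨d, ⟨hs.2.2.1.le, le_rfl⟩, rfl⟩

theorem FollowsLC.mono {W : Set V} {d : V} {tr tr' : List (Label V K N)}
    (h : FollowsLC W d tr) (hsub : tr' ⊆ tr) : FollowsLC W d tr' :=
  fun l hl => h l (hsub hl)

theorem DC.mono {W : Set V} {tr tr' : List (Label V K N)} (h : DC W tr) (hsub : tr' ⊆ tr) :
    DC W tr' :=
  fun d σ hl => h d σ (hsub hl)

theorem safe_of_executes {W : Set V} {e : V} (he : e ∈ W) {tr : List (Label V K N)}
    {q : Snapshot V N} (hex : (spatialModel V K N).Executes q tr) (hDC : DC W tr) (hLC : LC W tr)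
    (hego : FollowsLC Set.univ e tr) (h₀ : ∀ v, SpatialFormula.noCollision e q v) :
    Safe e tr := by
  induction tr generalizing q with
  | nil => intro l hl; cases hl
  | cons l tr ih =>
    obtain ⟨q', ⟨_, hs⟩ | ⟨hl, _⟩, hex⟩ := hex
    · have hhead : [l] ⊆ l :: tr := by simp
      have htail : tr ⊆ l :: tr := List.subset_cons_self l tr
      have hsafe := noCollision_of_step he hs (hDC.mono hhead) (fun d => (hLC d).mono hhead)
        (hego.mono hhead) (hs.1 ▸ h₀)
      have hq' : ∀ v, SpatialFormula.noCollision e q' v :=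
        hs.2.1 ▸ hsafe _ (Label.dst_mem_snapshots hs)
      intro l' hl'
      rcases List.mem_cons.1 hl' with rfl | hl'
      · exact hsafe
      · exact ih hex (hDC.mono htail) (fun d => (hLC d).mono htail) (hego.mono htail) hq' l' hl'
    · exact absurd trivial hl

theorem safe_of_mem_generalSpecification {W : Set V} {e : V} (he : e ∈ W)
    {tr : List (Label V K N)} (htr : tr ∈ GeneralSpecification W)
    (hego : FollowsLC Set.univ e tr) (h₀ : InitiallySafe e tr) : Safe e tr := by
  obtain ⟨⟨q, -, hex⟩, hDC, hLC⟩ := htr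
  cases tr with
  | nil => intro l hl; cases hl
  | cons l tr =>
    refine safe_of_executes he hex hDC hLC hego ?_
    -- The first step ties the model's starting state, otherwise arbitrary, to the source of the
    -- first label.
    obtain ⟨q', ⟨_, hs⟩ | ⟨hl, _⟩, -⟩ := hex
    · exact hs.1 ▸ h₀ l rfl
    · exact absurd trivial hl

end LaneChange

theorem mainTheorem3 {V K : Type*} {N : ℕ} {QA₁ QC₁ QM QA₂ QC₂ : Type*}
    (v₁ v₂ : V) (hv : v₁ ≠ v₂)
    (tdl tlc : ℝ) (ht : tdl < tlc) (n₁ n₂ : Fin N)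
    (view₁ view₂ : Snapshot V N → View N)
    (hview₁ : CoversClaim v₁ view₁) (hview₂ : CoversClaim v₂ view₂)
    (A₁ : Automaton (Label V K N) QA₁) (V₁ : Automaton (Label V K N) QC₁)
    (Comms12 : Automaton (Label V K N) QM)
    (A₂ : Automaton (Label V K N) QA₂) (V₂ : Automaton (Label V K N) QC₂)
    (S₁ S₂ : Automaton (Label V K N) (ControllerState N))
    (hS₁ : S₁ = spatialController K v₁ view₁ tdl tlc n₁)
    (hS₂ : S₂ = spatialController K v₂ view₂ tdl tlc n₂)
    (P : Automaton (Label V K N) _)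
    (hP : P = A₁ ⫴ V₁ ⫴ S₁ ⫴ Comms12 ⫴ A₂ ⫴ V₂ ⫴ S₂ ⫴ road V K N) :
    S₁.behaviour ∩ ReservesInPotentialCollision v₁ = ∅ ∧
    S₂.behaviour ∩ ReservesInPotentialCollision v₂ = ∅ ∧
    P.behaviour ∩ ReservesInPotentialCollision v₁ = ∅ ∧
    P.behaviour ∩ ReservesInPotentialCollision v₂ = ∅ ∧
    ∀ W : Set V, (W = {v₁, v₂} ∨ W = Set.univ) →
      ∀ tr ∈ P.behaviour, (∀ d, d ≠ v₁ → d ≠ v₂ → FollowsLC W d tr) →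
        LC W tr ∧
        (DC W tr →
          tr ∈ GeneralSpecification W ∧
          ((∀ e ∈ W, InitiallySafe e tr) → ∀ e ∈ W, Safe e tr)) := by
  have hc₁ : S₁.behaviour ∩ ReservesInPotentialCollision v₁ = ∅ :=
    hS₁ ▸ spatialController_inter_reservesInPotentialCollision hview₁ tdl tlc n₁
  have hc₂ : S₂.behaviour ∩ ReservesInPotentialCollision v₂ = ∅ :=
    hS₂ ▸ spatialController_inter_reservesInPotentialCollision hview₂ tdl tlc n₂
  have hR : P.behaviour ⊆ (road V K N).behaviour :=
    hP ▸ Automaton.behaviour_par_subset_right _ _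
  have hsub₂ : P.behaviour ⊆ S₂.behaviour := by
    rw [hP]
    exact (Automaton.behaviour_par_subset_left _ _).trans
      (Automaton.behaviour_par_subset_right _ _)
  have hsub₁ : P.behaviour ⊆ S₁.behaviour := by
    rw [hP]
    -- `⫴` associates to the left: this strips the road, `S₂`, `V₂`, `A₂` and `Comms12`.
    iterate 5 refine (Automaton.behaviour_par_subset_left _ _).trans ?_
    exact Automaton.behaviour_par_subset_right _ _
  have hp₁ : P.behaviour ∩ ReservesInPotentialCollision v₁ = ∅ :=
    Set.subset_empty_iff.1 (hc₁ ▸ Set.inter_subset_inter_left _ hsub₁)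
  have hp₂ : P.behaviour ∩ ReservesInPotentialCollision v₂ = ∅ :=
    Set.subset_empty_iff.1 (hc₂ ▸ Set.inter_subset_inter_left _ hsub₂)
  refine ⟨hc₁, hc₂, hp₁, hp₂, fun W hW tr htr hothers => ?_⟩
  -- Needed for `U = W` in the protocol and for `U = Set.univ` in safety.
  have hfollow₁ (U : Set V) : FollowsLC U v₁ tr :=
    followsLC_of_notMem fun h => (Set.ext_iff.1 hp₁ tr).1 ⟨htr, h⟩
  have hfollow₂ (U : Set V) : FollowsLC U v₂ tr :=
    followsLC_of_notMem fun h => (Set.ext_iff.1 hp₂ tr).1 ⟨htr, h⟩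
  have hLC : LC W tr := by
    intro d
    by_cases h₁ : d = v₁
    · exact h₁ ▸ hfollow₁ W
    by_cases h₂ : d = v₂
    · exact h₂ ▸ hfollow₂ W
    exact hothers d h₁ h₂
  refine ⟨hLC, fun hDC => ?_⟩
  have hspec : tr ∈ GeneralSpecification W := ⟨road_behaviour_subset (hR htr), hDC, hLC⟩
  refine ⟨hspec, fun h₀ e he => safe_of_mem_generalSpecification he hspec ?_ (h₀ e he)⟩
  -- For the platoon, respect for all vehicles comes from the controllers; for `W = Set.univ` it is
  -- `LC W` itself.
  rcases hW with rfl | rfl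
  · rcases he with rfl | rfl
    · exact hfollow₁ _
    · exact hfollow₂ _
  · exact hLC e
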